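/- Let $m\ge 1$ and let $a_1,\dots,a_m,b_1,\dots,b_m\in\mathbb{C}$ satisfy $\sum_{j=1}^m\Re(a_j+b_j+1)>1$. For $c\in\mathbb{C}$ and $n\in\mathbb{Z}$ write $(c)_n=\Gamma(c+n)/\Gamma(c)$, read by continuation at the poles of $\Gamma$, that is, $(c)_n=c(c+1)\cdots(c+n-1)$ for $n\ge0$ and $(c)_{-n}=1/\big((c-1)\cdots(c-n)\big)$ for $n\ge1$, and let $${}_mH_m\!\left[{c_1,\dots,c_m\atop d_1,\dots,d_m};z\right]=\sum_{n=-\infty}^{\infty}\frac{(c_1)_n\cdots(c_m)_n}{(d_1)_n\cdots(d_m)_n}\,z^n .$$ Put $$f(x)=\prod_{j=1}^m\frac{1}{\Gamma(a_j+1+x)\Gamma(b_j+1-x)},\qquad C_0=\prod_{j=1}^m\frac{1}{\Gamma(a_j+1)\Gamma(b_j+1)},$$ where $1/\Gamma$ denotes the entire function (zero at $0,-1,-2,\dots$), and let $g_m(x)=\dfrac{\sin(m\pi x)}{\sin(\pi x)}$, extended continuously to the integers. Assume that the series below is well defined, namely: if some $a_j=-1-N$ with an integer $N\ge0$, then $b_i\in\{0,1,\dots,N\}$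 for some $i$; and if some $b_j=-1-N$ with an integer $N\ge0$, then $a_i\in\{0,1,\dots,N\}$ for some $i$. (This holds in particular if no $a_j$ and no $b_j$ is a negative integer. In the remaining cases the series terminates before a term becomes undefined, and the terms beyond are taken to be $0$.) Then for all real $x$ $$g_m(x)=\begin{cases}1+2\sum_{n=1}^{(m-1)/2}\cos(2n\pi x)& m\text{ odd},\\[2pt] 2\sum_{n=1}^{m/2}\cos((2n-1)\pi x)& m\text{ even},\end{cases}$$ and for every $t\in[-\pi,\pi]$ the series and the integral below converge absolutely and $$C_0\;{}_mH_m\!\left[{-b_1,\dots,-b_m\atop a_1+1,\dots,a_m+1};-e^{-it}\right]=\int_{-\infty}^{\infty}f(x)\,e^{-ixt}\,g_m(x)\,dx .$$ -/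

import Mathlib

namespace BilateralHyp

/-- The shifted factorial `(c)_n = Γ(c + n) / Γ(c)` for `n : ℤ`: it is `c (c+1) ⋯ (c+n-1)` for
`n ≥ 0` and `1 / ((c-1)(c-2) ⋯ (c-k))` for `n = -k < 0`. The quotient of Gamma values is read by
continuation at the poles `c ∈ {0, -1, -2, …}`, so that for instance `(-M)_n = 0` for `n > M`. -/
noncomputable def shiftedFactorial (c : ℂ) : ℤ → ℂ
  | Int.ofNat n => ∏ k ∈ Finset.range n, (c + k)
  | Int.negSucc n => (∏ k ∈ Finset.range (n + 1), (c - (k + 1)))⁻¹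

/-- Away from the poles, the shifted factorial is the quotient of Gamma values. -/
theorem shiftedFactorial_eq_Gamma_div (c : ℂ) (hc : ∀ k : ℤ, c ≠ k) (n : ℤ) :
    shiftedFactorial c n = Complex.Gamma (c + n) / Complex.Gamma c := by
  have hG : Complex.Gamma c ≠ 0 :=
    Complex.Gamma_ne_zero fun k => by simpa using hc (-(k : ℤ))
  rcases n with n | n
  · rw [eq_div_iff hG]
    simp only [shiftedFactorial, Int.ofNat_eq_natCast, Int.cast_natCast]
    induction n with
    | zero => simp
    | succ n ih =>
      have h : c + n ≠ 0 := fun h => hc (-(n : ℤ)) (by push_cast; linear_combination h)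
      rw [Finset.prod_range_succ, mul_right_comm, ih, mul_comm, ← Complex.Gamma_add_one _ h]
      congr 1
      push_cast
      ring
  · rw [eq_div_iff hG]
    simp only [shiftedFactorial, Int.cast_negSucc]
    have key : ∀ N : ℕ, (∏ k ∈ Finset.range N, (c - (k + 1))) ≠ 0 ∧
        Complex.Gamma c = Complex.Gamma (c + -(N : ℂ)) *
          ∏ k ∈ Finset.range N, (c - (k + 1)) := by
      intro N
      induction N with
      | zero => simp
      | succ N ih =>
        have h : c - (N + 1) ≠ 0 := fun h => hc ((N : ℤ) + 1) (by
          push_cast; linear_combination h)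
        refine ⟨by rw [Finset.prod_range_succ]; exact mul_ne_zero ih.1 h, ?_⟩
        have e := Complex.Gamma_add_one _ h
        rw [show c - (N + 1) + 1 = c + -(N : ℂ) by ring] at e
        rw [Finset.prod_range_succ, ih.2, e]
        rw [show c + -((N + 1 : ℕ) : ℂ) = c - (N + 1) by push_cast; ring]
        ring
    obtain ⟨h0, h1⟩ := key (n + 1)
    rw [h1, mul_comm, mul_assoc, mul_inv_cancel₀ h0, mul_one]

/-- The `n`-th term `((c₁)_n ⋯ (c_p)_n) / ((d₁)_n ⋯ (d_q)_n) zⁿ` of the bilateral series. -/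
noncomputable def term {p q : ℕ} (c : Fin p → ℂ) (d : Fin q → ℂ) (z : ℂ) (n : ℤ) : ℂ :=
  (∏ j, shiftedFactorial (c j) n) / (∏ j, shiftedFactorial (d j) n) * z ^ n

/-- The bilateral hypergeometric series `pHq(c; d; z)`, the sum of its terms over all integers. -/
noncomputable def pHq {p q : ℕ} (c : Fin p → ℂ) (d : Fin q → ℂ) (z : ℂ) : ℂ :=
  ∑' n : ℤ, term c d z n

/-- The terms of the bilateral series with parameters `c`, `d` are well defined. This is so if no
`d j` lies in `{0, -1, -2, …}` and no `c j` lies in `{1, 2, 3, …}` (both conditions below are then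
void). More generally, `d j = -N` is harmless (it makes `(d j)_n` vanish for `n > N`) if the series
terminates to the right at some index `M ≤ N`, because some `c i = -M`; and `c j = N + 1` is
harmless if the series terminates to the left at some index `-M ≥ -N`, because some
`d i = M + 1`. -/
def WellDefined {p q : ℕ} (c : Fin p → ℂ) (d : Fin q → ℂ) : Prop :=
  (∀ (j : Fin q) (N : ℕ), d j = -(N : ℂ) → ∃ (i : Fin p) (M : ℕ), M ≤ N ∧ c i = -(M : ℂ)) ∧
  (∀ (j : Fin p) (N : ℕ), c j = (N : ℂ) + 1 → ∃ (i : Fin q) (M : ℕ), M ≤ N ∧ d i = (M : ℂ) + 1)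

/-- The generic case of well-definedness. -/
theorem WellDefined.of_generic {p q : ℕ} {c : Fin p → ℂ} {d : Fin q → ℂ}
    (hd : ∀ j, ∀ N : ℕ, d j ≠ -(N : ℂ)) (hc : ∀ j, ∀ N : ℕ, c j ≠ (N : ℂ) + 1) :
    WellDefined c d :=
  ⟨fun j N h => absurd h (hd j N), fun j N h => absurd h (hc j N)⟩

/-- `f(x) = 1 / ∏ⱼ Γ(aⱼ + 1 + x) Γ(bⱼ + 1 - x)`. Mathlib's `Gamma` is `0` at its poles, so this is
the entire function, with `1 / Γ = 0` at the poles of `Γ`. -/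
noncomputable def f {m : ℕ} (a b : Fin m → ℂ) (x : ℂ) : ℂ :=
  1 / ∏ j, (Complex.Gamma (a j + 1 + x) * Complex.Gamma (b j + 1 - x))

/-- `C₀ = 1 / ∏ⱼ Γ(aⱼ + 1) Γ(bⱼ + 1)`. -/
noncomputable def C₀ {m : ℕ} (a b : Fin m → ℂ) : ℂ :=
  1 / ∏ j, (Complex.Gamma (a j + 1) * Complex.Gamma (b j + 1))

/-- `g_m(x) = sin(mπx) / sin(πx)`, with the removable singularities at the integers filled in by
their limits `m cos(mπx) / cos(πx)`. -/
noncomputable def g (m : ℕ) (x : ℝ) : ℝ :=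
  if Real.sin (Real.pi * x) = 0 then
    m * Real.cos (m * Real.pi * x) / Real.cos (Real.pi * x)
  else Real.sin (m * Real.pi * x) / Real.sin (Real.pi * x)

end BilateralHyp

namespace BilateralHyp

open Complex Filter Topology MeasureTheory
open scoped FourierTransform

/-! The identity is Poisson summation for a band-limited function. Put `σ = ∑ Re(a_j + b_j + 1)`.
The entire function `f` is `O(|x|^(-σ))` on the real line and grows at most like a polynomial times
`exp(mπ|Im z|)` on the boundaries of large squares. Since `σ > 1`, shifting the contour shows that
its Fourier integral vanishes at every frequency `|s| ≥ mπ` (`integral_f_mul_exp_eq_zero`).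

The functional equation of `1/Γ` gives `C₀ · term n = f(n) ((-1)^m z)^n` (`C₀_mul_term`), and for `z
= -e^{-it}` the base is `e^{-is}` with `s = t - π(m-1)`. Poisson summation (`tsum_f_mul_exp`) turns
the series into the sum over `n` of the Fourier integrals at `s + 2πn`. For `|t| ≤ π` only `0 ≤ n <
m` survive (`tsum_integral_eq_sum_range`), and the corresponding `m` exponentials add up to
`e^{-ixt} g_m(x)` (`g_eq_sum_exp`). -/

/-! ### Bounds for quotients of Gamma values in a right half plane. -/

/-- For `r ≤ 1`, log-convexity bounds `Γ(u+1)` by interpolation between `Γ(u+r)` and `Γ(u+r+1)`; the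
2 comes from `u + r ≤ 2u`. Larger `r` follow from the functional equation with the same constant,
because `u ≤ u + (r-1)`. -/
theorem Gamma_le_rpow_neg_mul_Gamma_add {u r : ℝ} (hu : 1 ≤ u) (hr : 0 < r) :
    Real.Gamma u ≤ 2 * u ^ (-r) * Real.Gamma (u + r) := by
  have hu0 : 0 < u := by linarith
  have small : ∀ r : ℝ, 0 < r → r ≤ 1 →
      Real.Gamma u ≤ 2 * u ^ (-r) * Real.Gamma (u + r) := by
    intro r hr hr1
    have hG : 0 < Real.Gamma (u + r) := Real.Gamma_pos_of_pos (by linarith)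
    have key : Real.Gamma (u + 1) ≤ Real.Gamma (u + r) * (u + r) ^ (1 - r) := by
      rcases eq_or_lt_of_le hr1 with rfl | hr1
      · simp
      have h := Real.Gamma_mul_add_mul_le_rpow_Gamma_mul_rpow_Gamma
        (s := u + r) (t := u + r + 1) (a := r) (b := 1 - r) (by linarith) (by linarith) hr
        (by linarith) (by ring)
      rw [Real.Gamma_add_one (by linarith : u + r ≠ 0),
        Real.mul_rpow (by linarith) hG.le] at h
      have e : Real.Gamma (u + r) ^ r * Real.Gamma (u + r) ^ (1 - r) = Real.Gamma (u + r) := by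
        rw [← Real.rpow_add hG]; simp
      calc Real.Gamma (u + 1) = Real.Gamma (r * (u + r) + (1 - r) * (u + r + 1)) := by
            congr 1; ring
        _ ≤ _ := h
        _ = (Real.Gamma (u + r) ^ r * Real.Gamma (u + r) ^ (1 - r)) * (u + r) ^ (1 - r) := by ring
        _ = _ := by rw [e]
    have h2 : (u + r) ^ (1 - r) ≤ 2 * u ^ (1 - r) := by
      calc (u + r) ^ (1 - r) ≤ (2 * u) ^ (1 - r) :=
            Real.rpow_le_rpow (by linarith) (by linarith) (by linarith)
        _ = 2 ^ (1 - r) * u ^ (1 - r) := Real.mul_rpow (by norm_num) hu0.le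
        _ ≤ 2 ^ (1 : ℝ) * u ^ (1 - r) := by
            gcongr
            · norm_num
            · linarith
        _ = _ := by simp
    rw [Real.Gamma_add_one hu0.ne'] at key
    have h3 : u ^ (1 - r) = u * u ^ (-r) := by
      rw [sub_eq_add_neg, Real.rpow_add hu0, Real.rpow_one]
    rw [h3] at h2
    have h4 : u * Real.Gamma u ≤ u * (2 * u ^ (-r) * Real.Gamma (u + r)) := by
      calc u * Real.Gamma u ≤ Real.Gamma (u + r) * (u + r) ^ (1 - r) := key
        _ ≤ Real.Gamma (u + r) * (2 * (u * u ^ (-r))) := by gcongr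
        _ = _ := by ring
    exact le_of_mul_le_mul_left h4 hu0
  have all : ∀ n : ℕ, ∀ r : ℝ, 0 < r → r ≤ n + 1 →
      Real.Gamma u ≤ 2 * u ^ (-r) * Real.Gamma (u + r) := by
    intro n
    induction n with
    | zero => intro r hr h; exact small r hr (by simpa using h)
    | succ n ih =>
      intro r hr h
      rcases le_or_gt r 1 with h1 | h1
      · exact small r hr h1
      have h2 := ih (r - 1) (by linarith) (by push_cast at h; linarith)
      have hG : 0 < Real.Gamma (u + (r - 1)) := Real.Gamma_pos_of_pos (by linarith)
      have e : Real.Gamma (u + r) = (u + (r - 1)) * Real.Gamma (u + (r - 1)) := by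
        rw [← Real.Gamma_add_one (by linarith : u + (r - 1) ≠ 0)]; congr 1; ring
      have e2 : u ^ (-(r - 1)) = u ^ (-r) * u := by
        rw [show -(r - 1) = -r + 1 by ring, Real.rpow_add hu0, Real.rpow_one]
      rw [e]
      calc _ ≤ _ := h2
        _ = 2 * u ^ (-r) * (u * Real.Gamma (u + (r - 1))) := by rw [e2]; ring
        _ ≤ _ := by gcongr; linarith
  exact all ⌈r⌉₊ r hr (by linarith [Nat.le_ceil r])

theorem norm_betaIntegral_le {u v : ℂ} :
    ‖betaIntegral u v‖ ≤ (betaIntegral u.re v.re).re := by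
  have e : betaIntegral u.re v.re = ((∫ x : ℝ in (0 : ℝ)..1,
      ‖(x : ℂ) ^ (u - 1) * (1 - (x : ℂ)) ^ (v - 1)‖ : ℝ) : ℂ) := by
    rw [betaIntegral, ← intervalIntegral.integral_ofReal]
    refine intervalIntegral.integral_congr_ae ?_
    have h1 : ∀ᵐ x : ℝ, x ≠ 1 := by simp [ae_iff, measure_singleton]
    filter_upwards [h1] with x hx1 hx
    rw [Set.uIoc_of_le zero_le_one] at hx
    have hx' : 0 < 1 - x := by linarith [lt_of_le_of_ne hx.2 hx1]
    rw [norm_mul, norm_cpow_eq_rpow_re_of_pos hx.1, ← ofReal_one, ← ofReal_sub, ← ofReal_sub,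
      ← ofReal_sub, norm_cpow_eq_rpow_re_of_pos hx', ofReal_mul, ofReal_cpow hx.1.le,
      ofReal_cpow hx'.le]
    simp
  rw [e, ofReal_re, betaIntegral]
  exact intervalIntegral.norm_integral_le_integral_norm zero_le_one

/-- The quotient is `B(w, c) / Γ(c)`, and the modulus of a Beta integral is at most its value at the
real parts. This makes the bound uniform in `Im w`. -/
theorem norm_Gamma_div_Gamma_add_le {w c : ℂ} (hw : 1 ≤ w.re) (hc : 0 < c.re) :
    ‖Gamma w * (Gamma (w + c))⁻¹‖ ≤
      2 * (Real.Gamma c.re / ‖Gamma c‖) * w.re ^ (-c.re) := by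
  have hw0 : 0 < w.re := by linarith
  have hGc : 0 < ‖Gamma c‖ := norm_pos_iff.2 (Gamma_ne_zero_of_re_pos hc)
  have hGwc : Gamma (w + c) ≠ 0 := Gamma_ne_zero_of_re_pos (by simp; linarith)
  have hB := Gamma_mul_Gamma_eq_betaIntegral hw0 hc
  have hB' := Gamma_mul_Gamma_eq_betaIntegral (s := (w.re : ℂ)) (t := (c.re : ℂ)) (by simpa)
    (by simpa)
  have hR : 0 < Real.Gamma (w.re + c.re) := Real.Gamma_pos_of_pos (by linarith)
  have hb : (betaIntegral w.re c.re).re =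
      Real.Gamma w.re * Real.Gamma c.re / Real.Gamma (w.re + c.re) := by
    rw [← ofReal_add, Gamma_ofReal, Gamma_ofReal, Gamma_ofReal] at hB'
    have : betaIntegral w.re c.re =
        ((Real.Gamma w.re * Real.Gamma c.re / Real.Gamma (w.re + c.re) : ℝ) : ℂ) := by
      push_cast
      rw [hB', mul_div_cancel_left₀]
      exact_mod_cast hR.ne'
    rw [this, ofReal_re]
  have hn := norm_betaIntegral_le (u := w) (v := c)
  rw [hb] at hn
  have e : Gamma w * (Gamma (w + c))⁻¹ = betaIntegral w c / Gamma c := by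
    rw [eq_div_iff (norm_pos_iff.1 hGc), mul_right_comm, hB, mul_comm, ← mul_assoc,
      inv_mul_cancel₀ hGwc, one_mul]
  have hG := Gamma_le_rpow_neg_mul_Gamma_add hw hc
  have hcr : 0 < Real.Gamma c.re := Real.Gamma_pos_of_pos hc
  rw [e, norm_div, div_le_iff₀ hGc]
  calc ‖betaIntegral w c‖ ≤ Real.Gamma w.re * Real.Gamma c.re / Real.Gamma (w.re + c.re) := hn
    _ ≤ (2 * w.re ^ (-c.re) * Real.Gamma (w.re + c.re)) * Real.Gamma c.re /
        Real.Gamma (w.re + c.re) := by gcongr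
    _ = _ := by field_simp

/-- A bound for `Γ(w) / Γ(w + c)` in the half plane `1 ≤ Re w`, of the true order `|w| ^ (-Re c)`
in sectors about the real axis and of polynomial growth otherwise. -/
theorem exists_norm_Gamma_div_Gamma_add_le (c : ℂ) :
    ∃ (k : ℕ) (C : ℝ), 0 < c.re + k ∧ 0 ≤ C ∧ ∀ w : ℂ, 1 ≤ w.re →
      ‖Gamma w * (Gamma (w + c))⁻¹‖ ≤ C * ‖w‖ ^ k * w.re ^ (-(c.re + k)) := by
  have main : ∀ (k : ℕ) (c : ℂ), 0 < c.re + k → ∃ C : ℝ, 0 ≤ C ∧ ∀ w : ℂ, 1 ≤ w.re →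
      ‖Gamma w * (Gamma (w + c))⁻¹‖ ≤ C * ‖w‖ ^ k * w.re ^ (-(c.re + k)) := by
    intro k
    induction k with
    | zero =>
      intro c hc
      have hc' : 0 < c.re := by simpa using hc
      refine ⟨2 * (Real.Gamma c.re / ‖Gamma c‖), ?_, fun w hw => ?_⟩
      · have := Real.Gamma_pos_of_pos hc'
        positivity
      · simpa using norm_Gamma_div_Gamma_add_le hw hc'
    | succ k ih =>
      intro c hc
      obtain ⟨C, hC, h⟩ := ih (c + 1) (by push_cast at hc; simp; linarith)
      refine ⟨C * (1 + ‖c‖), by positivity, fun w hw => ?_⟩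
      have h1 : 1 ≤ ‖w‖ := hw.trans ((le_abs_self _).trans (abs_re_le_norm w))
      have h2 : ‖w + c‖ ≤ (1 + ‖c‖) * ‖w‖ := by
        nlinarith [norm_add_le w c, norm_nonneg c]
      -- Raising `c` by 1 costs a factor `w + c`, hence one power of `‖w‖`; `k` counts the shifts
      -- needed to make the real part positive.
      rw [one_div_Gamma_eq_self_mul_one_div_Gamma_add_one (w + c), mul_left_comm, norm_mul,
        add_assoc]
      have e : -((c + 1).re + k) = -(c.re + (k + 1 : ℕ)) := by simp; ring
      have h3 := h w hw
      rw [e] at h3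
      calc _ ≤ ((1 + ‖c‖) * ‖w‖) * (C * ‖w‖ ^ k * w.re ^ (-(c.re + (k + 1 : ℕ)))) := by gcongr
        _ = _ := by ring
  obtain ⟨k, hk⟩ := exists_nat_gt (-c.re)
  obtain ⟨C, hC, h⟩ := main k c (by linarith)
  exact ⟨k, C, by linarith, hC, h⟩

/-! ### Growth of `f` on the sides of large squares and its integrability on the real line. -/

/-- The factor `1 / (Γ(a + 1 + z) Γ(b + 1 - z))` of `f`. -/
noncomputable def factor (a b z : ℂ) : ℂ := (Gamma (a + 1 + z))⁻¹ * (Gamma (b + 1 - z))⁻¹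

/-- This symmetry reduces estimates in the left half plane to the right one. -/
theorem factor_neg (a b z : ℂ) : factor a b (-z) = factor b a z := by
  simp only [factor, sub_neg_eq_add, ← sub_eq_add_neg, mul_comm]

theorem f_eq_prod_factor {m : ℕ} (a b : Fin m → ℂ) (z : ℂ) :
    f a b z = ∏ j, factor (a j) (b j) z := by
  simp [f, factor, Finset.prod_mul_distrib, mul_comm]

theorem f_neg {m : ℕ} (a b : Fin m → ℂ) (z : ℂ) : f a b (-z) = f b a z := by
  simp only [f_eq_prod_factor, factor_neg]

theorem differentiable_factor (a b : ℂ) : Differentiable ℂ (factor a b) :=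
  (differentiable_one_div_Gamma.comp (by fun_prop : Differentiable ℂ fun z : ℂ => a + 1 + z)).mul
    (differentiable_one_div_Gamma.comp (by fun_prop : Differentiable ℂ fun z : ℂ => b + 1 - z))

theorem differentiable_f {m : ℕ} (a b : Fin m → ℂ) : Differentiable ℂ (f a b) := by
  have : f a b = fun z => ∏ j, factor (a j) (b j) z := funext (f_eq_prod_factor a b)
  rw [this]
  exact Differentiable.fun_finsetProd fun j _ => differentiable_factor _ _

theorem norm_sin_le_exp_abs_im (z : ℂ) : ‖Complex.sin z‖ ≤ Real.exp |z.im| := by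
  have h1 : ‖cexp (-z * I)‖ ≤ Real.exp |z.im| := by
    rw [norm_exp]; simpa using le_abs_self _
  have h2 : ‖cexp (z * I)‖ ≤ Real.exp |z.im| := by
    rw [norm_exp]; simpa using neg_le_abs _
  rw [Complex.sin, norm_div, norm_mul, norm_I, mul_one, Complex.norm_ofNat]
  linarith [norm_sub_le (cexp (-z * I)) (cexp (z * I))]

/-- Reflection moves the argument `b + 1 - z`, which runs to the left, into the right half plane;
the sine carries the whole exponential type `π`. -/
theorem factor_eq_Gamma_div_mul_sin {a b z : ℂ} (h : 0 < (z - b).re) :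
    factor a b z = Gamma (z - b) * (Gamma (z - b + (a + b + 1)))⁻¹ *
      (Complex.sin (Real.pi * (z - b)) / Real.pi) := by
  have hG : Gamma (z - b) ≠ 0 := Gamma_ne_zero_of_re_pos h
  have hr := Gamma_mul_Gamma_one_sub (z - b)
  have e : (Gamma (b + 1 - z))⁻¹ = Gamma (z - b) * (Complex.sin (Real.pi * (z - b)) / Real.pi) := by
    rw [show 1 - (z - b) = b + 1 - z by ring] at hr
    rw [← inv_div, ← hr, mul_inv, mul_inv_cancel_left₀ hG]
  rw [factor, e, show a + 1 + z = z - b + (a + b + 1) by ring]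
  ring

theorem exists_norm_Gamma_sub_div_Gamma_add_le (a b : ℂ) :
    ∃ (k : ℕ) (C R₀ : ℝ), 0 < (a + b + 1).re + k ∧ 0 ≤ C ∧ 1 ≤ R₀ ∧ ∀ z : ℂ, R₀ ≤ z.re →
      0 < (z - b).re ∧ ‖Gamma (z - b) * (Gamma (z - b + (a + b + 1)))⁻¹‖ ≤
        C * ‖z‖ ^ k * z.re ^ (-((a + b + 1).re + k)) := by
  obtain ⟨k, C, hk, hC, h⟩ := exists_norm_Gamma_div_Gamma_add_le (a + b + 1)
  set p : ℝ := (a + b + 1).re + k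
  -- The threshold gives `Re(z-b) ≥ max(1, Re z / 2)` and `‖z-b‖ ≤ 2‖z‖`; these two halvings produce
  -- `2^p` and `2^k`.
  refine ⟨k, C * 2 ^ k * 2 ^ p, 2 * ‖b‖ + 2, hk, by positivity,
    by linarith [norm_nonneg b], fun z hz => ?_⟩
  have hb := norm_nonneg b
  have hbr := (abs_le.1 (abs_re_le_norm b)).2
  have hre : z.re / 2 ≤ (z - b).re := by rw [sub_re]; linarith
  have hz0 : 0 < z.re := by linarith
  have hw1 : 1 ≤ (z - b).re := by linarith
  have hzn : z.re ≤ ‖z‖ := (le_abs_self _).trans (abs_re_le_norm z)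
  have hwn : ‖z - b‖ ≤ 2 * ‖z‖ := by linarith [norm_sub_le z b]
  have hpow : (z - b).re ^ (-p) ≤ 2 ^ p * z.re ^ (-p) := by
    calc (z - b).re ^ (-p) ≤ (z.re / 2) ^ (-p) :=
          Real.rpow_le_rpow_of_nonpos (by linarith) hre (by linarith)
      _ = 2 ^ p * z.re ^ (-p) := by
          rw [Real.div_rpow hz0.le (by norm_num), Real.rpow_neg zero_le_two, div_inv_eq_mul,
            mul_comm]
  refine ⟨by linarith, ?_⟩
  calc _ ≤ C * (2 * ‖z‖) ^ k * (2 ^ p * z.re ^ (-p)) := (h _ hw1).trans (by gcongr)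
    _ = _ := by rw [mul_pow]; ring

theorem exists_norm_factor_le (a b : ℂ) :
    ∃ (k : ℕ) (C R₀ : ℝ), 0 < (a + b + 1).re + k ∧ 0 ≤ C ∧ 1 ≤ R₀ ∧ ∀ z : ℂ, R₀ ≤ z.re →
      ‖factor a b z‖ ≤
        C * ‖z‖ ^ k * z.re ^ (-((a + b + 1).re + k)) * Real.exp (Real.pi * |z.im|) := by
  obtain ⟨k, C, R₀, hk, hC, hR₀, h⟩ := exists_norm_Gamma_sub_div_Gamma_add_le a b
  refine ⟨k, C * Real.exp (Real.pi * ‖b‖), R₀, hk, by positivity, hR₀, fun z hz => ?_⟩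
  obtain ⟨hpos, hG⟩ := h z hz
  have hz0 : 0 < z.re := by linarith
  have hsin : ‖Complex.sin (Real.pi * (z - b)) / Real.pi‖ ≤
      Real.exp (Real.pi * ‖b‖) * Real.exp (Real.pi * |z.im|) := by
    rw [norm_div, norm_real, Real.norm_eq_abs, abs_of_pos Real.pi_pos, ← Real.exp_add]
    refine (div_le_self (norm_nonneg _) (by linarith [Real.pi_gt_three])).trans
      ((norm_sin_le_exp_abs_im _).trans (Real.exp_le_exp.2 ?_))
    rw [im_ofReal_mul, abs_mul, abs_of_pos Real.pi_pos, ← mul_add, sub_im]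
    gcongr
    linarith [abs_sub z.im b.im, abs_im_le_norm b]
  rw [factor_eq_Gamma_div_mul_sin hpos, norm_mul]
  calc _ ≤ (C * ‖z‖ ^ k * z.re ^ (-((a + b + 1).re + k))) *
        (Real.exp (Real.pi * ‖b‖) * Real.exp (Real.pi * |z.im|)) := by gcongr
    _ = _ := by ring

theorem factor_mul_sub (a b z : ℂ) :
    factor a b z * (b - z) = (a + 1 + z) * factor a b (z + 1) := by
  have h1 := one_div_Gamma_eq_self_mul_one_div_Gamma_add_one (a + 1 + z)
  have h2 := one_div_Gamma_eq_self_mul_one_div_Gamma_add_one (b - z)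
  rw [show b - z + 1 = b + 1 - z by ring] at h2
  rw [factor, factor, show a + 1 + (z + 1) = a + 1 + z + 1 by ring,
    show b + 1 - (z + 1) = b - z by ring, h1, h2]
  ring

/-- One unit shift multiplies by `(a+1+z)/(b-z) = (a+b+1)/(b-z) - 1`, which is bounded when `|b-z| ≥
1`. It carries points near the imaginary axis into the region of `exists_norm_factor_le`. -/
theorem norm_factor_le_norm_factor_add_nat (a b z : ℂ) (hz : 1 ≤ |(b - z).im|) (n : ℕ) :
    ‖factor a b z‖ ≤ (1 + ‖a + b + 1‖) ^ n * ‖factor a b (z + n)‖ := by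
  induction n with
  | zero => simp
  | succ n ih =>
    have h1 : 1 ≤ ‖b - (z + n)‖ := by
      refine hz.trans (le_trans (le_of_eq ?_) (abs_im_le_norm _))
      simp
    have h2 : ‖a + 1 + (z + n)‖ ≤ (1 + ‖a + b + 1‖) * ‖b - (z + n)‖ := by
      have := norm_sub_le (a + b + 1) (b - (z + n))
      rw [show a + b + 1 - (b - (z + n)) = a + 1 + (z + n) by ring] at this
      nlinarith [norm_nonneg (a + b + 1)]
    have h3 := congrArg norm (factor_mul_sub a b (z + n))
    rw [norm_mul, norm_mul] at h3
    have h4 : ‖factor a b (z + n)‖ ≤ (1 + ‖a + b + 1‖) * ‖factor a b (z + n + 1)‖ := by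
      refine le_of_mul_le_mul_right (a := ‖b - (z + n)‖) ?_ (by linarith)
      rw [h3]
      calc _ ≤ ((1 + ‖a + b + 1‖) * ‖b - (z + n)‖) * ‖factor a b (z + n + 1)‖ := by gcongr
        _ = _ := by ring
    rw [Nat.cast_succ, ← add_assoc, pow_succ, mul_assoc]
    exact ih.trans (by gcongr)

/-- Here `‖z‖ ≤ 2R`, so the surplus powers `‖z‖^k R^(-k)` are bounded and the true decay rate
remains. -/
theorem norm_factor_le_on_sides (a b : ℂ) :
    ∃ C : ℝ, 0 ≤ C ∧ ∀ᶠ R : ℝ in atTop, ∀ z : ℂ, |z.re| = R → |z.im| ≤ R →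
      ‖factor a b z‖ ≤ C * R ^ (-(a + b + 1).re) * Real.exp (Real.pi * |z.im|) := by
  have pos : ∀ a b : ℂ, ∃ C : ℝ, 0 ≤ C ∧ ∀ᶠ R : ℝ in atTop, ∀ z : ℂ, z.re = R → |z.im| ≤ R →
      ‖factor a b z‖ ≤ C * R ^ (-(a + b + 1).re) * Real.exp (Real.pi * |z.im|) := by
    intro a b
    obtain ⟨k, C, R₀, hk, hC, hR₀, h⟩ := exists_norm_factor_le a b
    refine ⟨C * 2 ^ k, by positivity, ?_⟩
    filter_upwards [eventually_ge_atTop R₀] with R hR z hz him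
    subst hz
    have hz0 : 0 < z.re := by linarith
    have hn : ‖z‖ ≤ 2 * z.re := by
      have := norm_le_abs_re_add_abs_im z
      rw [abs_of_pos hz0] at this
      linarith
    refine (h z hR).trans (mul_le_mul_of_nonneg_right ?_ (Real.exp_nonneg _))
    calc C * ‖z‖ ^ k * z.re ^ (-((a + b + 1).re + k))
        ≤ C * (2 * z.re) ^ k * z.re ^ (-((a + b + 1).re + k)) := by gcongr
      _ = C * 2 ^ k * z.re ^ (-(a + b + 1).re) := by
        rw [neg_add, Real.rpow_add hz0, Real.rpow_neg hz0.le (k : ℝ), Real.rpow_natCast, mul_pow]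
        field_simp
  obtain ⟨C₁, hC₁, h₁⟩ := pos a b
  obtain ⟨C₂, hC₂, h₂⟩ := pos b a
  refine ⟨max C₁ C₂, le_max_of_le_left hC₁, ?_⟩
  filter_upwards [h₁, h₂, eventually_ge_atTop 0] with R h₁ h₂ hR z hz him
  rcases abs_eq hR |>.1 hz with h | h
  · refine (h₁ z h him).trans ?_
    gcongr
    exact le_max_left _ _
  · have := h₂ (-z) (by simp [h]) (by simpa using him)
    rw [factor_neg, neg_im, abs_neg, add_comm b a] at this
    refine this.trans ?_
    gcongr
    exact le_max_right _ _

/-- A polynomial loss is harmless here: the strict gap `s > τ` in the contour argument supplies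
exponential decay. -/
theorem norm_factor_le_on_bottom (a b : ℂ) :
    ∃ (k : ℕ) (C : ℝ), 0 ≤ C ∧ ∀ᶠ R : ℝ in atTop, ∀ z : ℂ, |z.im| = R → |z.re| ≤ R →
      ‖factor a b z‖ ≤ C * R ^ k * Real.exp (Real.pi * |z.im|) := by
  have pos : ∀ a b : ℂ, ∃ (k : ℕ) (C : ℝ), 0 ≤ C ∧ ∀ᶠ R : ℝ in atTop, ∀ z : ℂ, |z.im| = R →
      0 ≤ z.re → |z.re| ≤ R → ‖factor a b z‖ ≤ C * R ^ k * Real.exp (Real.pi * |z.im|) := by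
    intro a b
    obtain ⟨k, C, R₀, hk, hC, hR₀, h⟩ := exists_norm_factor_le a b
    obtain ⟨n, hn⟩ := exists_nat_ge R₀
    refine ⟨k, (1 + ‖a + b + 1‖) ^ n * (C * (2 + n) ^ k), by positivity, ?_⟩
    filter_upwards [eventually_ge_atTop (1 + ‖b‖), eventually_ge_atTop 1] with R hR hR1 z hz hre hreR
    have h1 : 1 ≤ |(b - z).im| := by
      rw [sub_im, abs_sub_comm]
      linarith [abs_sub_abs_le_abs_sub z.im b.im, abs_im_le_norm b]
    have hz1 : R₀ ≤ (z + n).re := by simp; linarith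
    have h2 := h (z + n) hz1
    have h0 : 0 ≤ (z + n).re := by linarith
    have h3 : (z + n).re ^ (-((a + b + 1).re + k)) ≤ 1 :=
      Real.rpow_le_one_of_one_le_of_nonpos (by linarith) (by linarith)
    have h4 : ‖z + n‖ ≤ (2 + n) * R := by
      have h5 := norm_add_le z n
      rw [norm_natCast] at h5
      nlinarith [norm_le_abs_re_add_abs_im z, Nat.cast_nonneg (α := ℝ) n]
    refine (norm_factor_le_norm_factor_add_nat a b z h1 n).trans ?_
    calc _ ≤ (1 + ‖a + b + 1‖) ^ n *
          (C * ((2 + n) * R) ^ k * 1 * Real.exp (Real.pi * |z.im|)) := by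
          gcongr
          refine h2.trans ?_
          rw [add_im, natCast_im, add_zero]
          gcongr
      _ = _ := by rw [mul_pow]; ring
  obtain ⟨k₁, C₁, hC₁, h₁⟩ := pos a b
  obtain ⟨k₂, C₂, hC₂, h₂⟩ := pos b a
  refine ⟨max k₁ k₂, max C₁ C₂, le_max_of_le_left hC₁, ?_⟩
  filter_upwards [h₁, h₂, eventually_ge_atTop 1] with R h₁ h₂ hR z hz hre
  have hC : 0 ≤ max C₁ C₂ := le_max_of_le_left hC₁
  rcases le_total 0 z.re with h | h
  · refine (h₁ z hz h hre).trans ?_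
    gcongr
    · exact le_max_left _ _
    · exact le_max_left _ _
  · have := h₂ (-z) (by simpa using hz) (by simpa using h) (by simpa using hre)
    rw [factor_neg, neg_im, abs_neg] at this
    refine this.trans ?_
    gcongr
    · exact le_max_right _ _
    · exact le_max_right _ _

theorem norm_f_le_on_sides {m : ℕ} (a b : Fin m → ℂ) :
    ∃ C : ℝ, 0 ≤ C ∧ ∀ᶠ R : ℝ in atTop, ∀ z : ℂ, |z.re| = R → |z.im| ≤ R →
      ‖f a b z‖ ≤ C * R ^ (-∑ j, (a j + b j + 1).re) * Real.exp (m * Real.pi * |z.im|) := by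
  choose C hC h using fun j => norm_factor_le_on_sides (a j) (b j)
  refine ⟨∏ j, C j, Finset.prod_nonneg fun j _ => hC j, ?_⟩
  filter_upwards [eventually_all.2 h, eventually_gt_atTop 0] with R h hR z hz him
  rw [f_eq_prod_factor, norm_prod]
  refine (Finset.prod_le_prod (fun j _ => norm_nonneg _) fun j _ => h j z hz him).trans
    (le_of_eq ?_)
  rw [Finset.prod_mul_distrib, Finset.prod_mul_distrib, ← Real.rpow_sum_of_pos hR,
    Finset.sum_neg_distrib, Finset.prod_const, Finset.card_univ, Fintype.card_fin,
    ← Real.exp_nat_mul, mul_assoc (m : ℝ)]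

theorem norm_f_le_on_bottom {m : ℕ} (a b : Fin m → ℂ) :
    ∃ (k : ℕ) (C : ℝ), 0 ≤ C ∧ ∀ᶠ R : ℝ in atTop, ∀ z : ℂ, |z.im| = R → |z.re| ≤ R →
      ‖f a b z‖ ≤ C * R ^ k * Real.exp (m * Real.pi * |z.im|) := by
  choose k C hC h using fun j => norm_factor_le_on_bottom (a j) (b j)
  refine ⟨∑ j, k j, ∏ j, C j, Finset.prod_nonneg fun j _ => hC j, ?_⟩
  filter_upwards [eventually_all.2 h] with R h z hz hre
  rw [f_eq_prod_factor, norm_prod]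
  refine (Finset.prod_le_prod (fun j _ => norm_nonneg _) fun j _ => h j z hz hre).trans
    (le_of_eq ?_)
  rw [Finset.prod_mul_distrib, Finset.prod_mul_distrib, Finset.prod_pow_eq_pow_sum,
    Finset.prod_const, Finset.card_univ, Fintype.card_fin, ← Real.exp_nat_mul, mul_assoc (m : ℝ)]

theorem f_isBigO_cocompact {m : ℕ} (a b : Fin m → ℂ) :
    (fun x : ℝ => f a b x) =O[cocompact ℝ] fun x => |x| ^ (-∑ j, (a j + b j + 1).re) := by
  obtain ⟨C, hC, h⟩ := norm_f_le_on_sides a b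
  refine Asymptotics.IsBigO.of_bound C ?_
  have ht : Tendsto (fun x : ℝ => |x|) (cocompact ℝ) atTop := tendsto_norm_cocompact_atTop
  filter_upwards [ht.eventually h] with x hx
  have := hx x (by simp) (by simp)
  rw [Real.norm_of_nonneg (by positivity)]
  simpa using this

theorem integrable_f {m : ℕ} {a b : Fin m → ℂ} (hab : 1 < ∑ j, (a j + b j + 1).re) :
    Integrable fun x : ℝ => f a b x := by
  have hc : Continuous fun x : ℝ => f a b x :=
    (differentiable_f a b).continuous.comp continuous_ofReal
  refine hc.locallyIntegrable.integrable_of_isBigO_cocompact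
    (g := fun x : ℝ => (1 + ‖x‖) ^ (-∑ j, (a j + b j + 1).re))
    ((f_isBigO_cocompact a b).trans ?_) ?_
  · refine Asymptotics.IsBigO.of_bound (2 ^ (∑ j, (a j + b j + 1).re)) ?_
    have ht : Tendsto (fun x : ℝ => ‖x‖) (cocompact ℝ) atTop := tendsto_norm_cocompact_atTop
    filter_upwards [ht.eventually (eventually_ge_atTop 1)] with x hx
    rw [Real.norm_of_nonneg (by positivity), Real.norm_of_nonneg (by positivity),
      Real.rpow_neg (by positivity), Real.rpow_neg (by positivity), ← div_eq_mul_inv,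
      le_div_iff₀ (by positivity), inv_mul_le_iff₀ (by positivity), mul_comm,
      ← Real.mul_rpow (by positivity) (by norm_num)]
    refine Real.rpow_le_rpow (by positivity) ?_ (by linarith)
    rw [Real.norm_eq_abs] at *
    linarith
  · exact (integrable_one_add_norm (by simpa using hab)).integrableAtFilter _

/-! ### Vanishing of the Fourier integral outside the band. -/

theorem norm_exp_neg_I_mul_mul (x s : ℝ) : ‖cexp (-(I * x * s))‖ = 1 := by
  rw [norm_exp]; simp

theorem integrable_mul_exp {F : ℝ → ℂ} (hF : Integrable F) (s : ℝ) :
    Integrable fun x : ℝ => F x * cexp (-(I * x * s)) :=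
  hF.mul_bdd (c := 1) (by fun_prop) (.of_forall fun x => (norm_exp_neg_I_mul_mul x s).le)

/-- A function of exponential type `τ` with integrable decay on the real line has vanishing
Fourier integral at every frequency `s > τ`. -/
theorem integral_mul_exp_eq_zero_of_bounds {F : ℂ → ℂ} (hF : Differentiable ℂ F)
    (hint : Integrable fun x : ℝ => F x) {τ p s C₁ C₂ : ℝ} {k : ℕ} (hp : 1 < p) (hs : τ < s)
    (hC₁ : 0 ≤ C₁)
    (h₁ : ∀ᶠ R : ℝ in atTop, ∀ z : ℂ, |z.re| = R → |z.im| ≤ R →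
      ‖F z‖ ≤ C₁ * R ^ (-p) * Real.exp (τ * |z.im|))
    (h₂ : ∀ᶠ R : ℝ in atTop, ∀ z : ℂ, |z.im| = R → |z.re| ≤ R →
      ‖F z‖ ≤ C₂ * R ^ k * Real.exp (τ * |z.im|)) :
    ∫ x : ℝ, F x * cexp (-(I * x * s)) = 0 := by
  set G : ℂ → ℂ := fun z => F z * cexp (-(I * z * s)) with hG
  have hGd : Differentiable ℂ G := hF.mul (by fun_prop)
  have hGn : ∀ z, ‖G z‖ = ‖F z‖ * Real.exp (s * z.im) := fun z => by
    simp only [hG, norm_mul, norm_exp]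
    simp [mul_comm]
  have hGi : Integrable fun x : ℝ => G x := integrable_mul_exp hint s
  have hlim : Tendsto (fun R : ℝ => ∫ x in (-R)..R, G x) atTop (𝓝 (∫ x : ℝ, G x)) :=
    intervalIntegral_tendsto_integral hGi tendsto_neg_atTop_atBot tendsto_id
  have hbound : ∀ᶠ R : ℝ in atTop, ‖∫ x in (-R)..R, G x‖ ≤
      2 * C₂ * (R ^ (k + 1 : ℝ) * Real.exp (-(s - τ) * R)) + 2 * C₁ * R ^ (-(p - 1)) := by
    filter_upwards [h₁, h₂, eventually_gt_atTop 0] with R h₁ h₂ hR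
    -- The rectangle `[-R, R] × [-R, 0]` lies in the lower half plane, where `|e^{-izs}| = e^{s Im
    -- z}` beats the growth `e^{τ|Im z|}`. The vertical sides contribute `O(R^(1-p))`, hence `p >
    -- 1`.
    have hrect := integral_boundary_rect_eq_zero_of_differentiableOn G (⟨-R, -R⟩ : ℂ) (R : ℂ)
      hGd.differentiableOn
    simp only [ofReal_re, ofReal_im, ofReal_zero, zero_mul, add_zero, smul_eq_mul] at hrect
    have hbot : ‖∫ x : ℝ in (-R)..R, G (x + (-R : ℝ) * I)‖ ≤
        (C₂ * R ^ k * Real.exp (-(s - τ) * R)) * |R - (-R)| := by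
      refine intervalIntegral.norm_integral_le_of_norm_le_const fun x hx => ?_
      rw [Set.uIoc_of_le (by linarith)] at hx
      have := h₂ (x + (-R : ℝ) * I) (by simp [abs_of_pos hR])
        (by simpa using abs_le.2 ⟨hx.1.le, hx.2⟩)
      rw [hGn]
      calc _ ≤ _ := mul_le_mul_of_nonneg_right this (Real.exp_nonneg _)
        _ = C₂ * R ^ k * (Real.exp (τ * R) * Real.exp (s * -R)) := by
          simp [abs_of_pos hR, mul_assoc]
        _ = _ := by rw [← Real.exp_add]; ring_nf
    have hside : ∀ r : ℝ, |r| = R → ‖∫ y : ℝ in (-R)..0, G (r + y * I)‖ ≤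
        (C₁ * R ^ (-p)) * |0 - (-R)| := by
      intro r hr
      refine intervalIntegral.norm_integral_le_of_norm_le_const fun y hy => ?_
      rw [Set.uIoc_of_le (by linarith)] at hy
      have hy' : |y| = -y := abs_of_nonpos hy.2
      have := h₁ (r + y * I) (by simpa using hr) (by simp [hy']; linarith [hy.1])
      rw [hGn]
      calc _ ≤ _ := mul_le_mul_of_nonneg_right this (Real.exp_nonneg _)
        _ = C₁ * R ^ (-p) * Real.exp ((s - τ) * y) := by
          rw [mul_assoc, ← Real.exp_add]
          congr 2
          simp [hy']
          ring
        _ ≤ C₁ * R ^ (-p) * 1 := by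
          gcongr
          exact Real.exp_le_one_iff.2 (mul_nonpos_of_nonneg_of_nonpos (by linarith) hy.2)
        _ = _ := mul_one _
    have h3 := hside R (abs_of_pos hR)
    have h4 := hside (-R) (by rw [abs_neg, abs_of_pos hR])
    have hkey : ∫ x in (-R)..R, G x = (∫ x : ℝ in (-R)..R, G (x + (-R : ℝ) * I)) +
        I * (∫ y : ℝ in (-R)..0, G (R + y * I)) -
        I * (∫ y : ℝ in (-R)..0, G ((-R : ℝ) + y * I)) := by
      linear_combination -hrect
    rw [hkey]
    have e1 : |R - -R| = 2 * R := by rw [abs_of_pos (by linarith)]; ring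
    have e2 : |0 - -R| = R := by rw [abs_of_pos (by linarith)]; ring
    have e3 : R ^ (k + 1 : ℝ) = R ^ k * R := by
      rw [Real.rpow_add hR, Real.rpow_natCast, Real.rpow_one]
    have e4 : R ^ (-(p - 1)) = R ^ (-p) * R := by
      rw [neg_sub, sub_eq_neg_add, Real.rpow_add hR, Real.rpow_one]
    rw [e1] at hbot
    rw [e2] at h3 h4
    rw [e3, e4]
    refine (norm_sub_le _ _).trans ((add_le_add_left (norm_add_le _ _) _).trans ?_)
    rw [norm_mul, norm_mul, norm_I, one_mul, one_mul]
    linarith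
  have hzero : Tendsto (fun R : ℝ => 2 * C₂ * (R ^ (k + 1 : ℝ) * Real.exp (-(s - τ) * R)) +
      2 * C₁ * R ^ (-(p - 1))) atTop (𝓝 0) := by
    simpa using ((tendsto_rpow_mul_exp_neg_mul_atTop_nhds_zero _ _ (sub_pos.2 hs)).const_mul
      (2 * C₂)).add ((tendsto_rpow_neg_atTop (sub_pos.2 hp)).const_mul (2 * C₁))
  exact tendsto_nhds_unique hlim (squeeze_zero_norm' hbound hzero)

theorem continuous_integral_mul_exp {F : ℝ → ℂ} (hF : Integrable F) :
    Continuous fun s : ℝ => ∫ x : ℝ, F x * cexp (-(I * x * s)) := by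
  refine continuous_of_dominated (bound := fun x => ‖F x‖)
    (fun s => (integrable_mul_exp hF s).aestronglyMeasurable) (fun s => .of_forall fun x => ?_)
    hF.norm (.of_forall fun x => by fun_prop)
  rw [norm_mul, norm_exp_neg_I_mul_mul, mul_one]

/-- The contour argument needs `s > mπ`; continuity in `s` adds the endpoint, which occurs when `t =
±π`. Negative `s` follow from `x ↦ -x`, which swaps `a` and `b`. -/
theorem integral_f_mul_exp_eq_zero {m : ℕ} {a b : Fin m → ℂ}
    (hab : 1 < ∑ j, (a j + b j + 1).re) {s : ℝ} (hs : m * Real.pi ≤ |s|) :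
    ∫ x : ℝ, f a b x * cexp (-(I * x * s)) = 0 := by
  have pos : ∀ a b : Fin m → ℂ, 1 < ∑ j, (a j + b j + 1).re → ∀ s : ℝ, m * Real.pi ≤ s →
      ∫ x : ℝ, f a b x * cexp (-(I * x * s)) = 0 := by
    intro a b hab s hs
    have hint := integrable_f hab
    obtain ⟨C₁, hC₁, h₁⟩ := norm_f_le_on_sides a b
    obtain ⟨k, C₂, -, h₂⟩ := norm_f_le_on_bottom a b
    have hset : Set.EqOn (fun s : ℝ => ∫ x : ℝ, f a b x * cexp (-(I * x * s))) (fun _ => 0)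
        (Set.Ioi (m * Real.pi)) := fun s hs =>
      integral_mul_exp_eq_zero_of_bounds (differentiable_f a b) hint hab hs hC₁ h₁ h₂
    refine hset.closure (continuous_integral_mul_exp hint) continuous_const ?_
    rw [closure_Ioi]
    exact hs
  rcases le_abs.1 hs with h | h
  · exact pos a b hab s h
  · have := pos b a (by simpa only [add_comm (b _)] using hab) (-s) h
    rw [← integral_neg_eq_self] at this
    rw [← this]
    congr 1
    ext x
    rw [← f_neg b a]
    push_cast
    ring_nf

/-! ### The terms of the series as values of `f` at the integers, and absolute convergence. -/

theorem shiftedFactorial_natCast (c : ℂ) (n : ℕ) :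
    shiftedFactorial c n = ∏ k ∈ Finset.range n, (c + k) := rfl

theorem shiftedFactorial_zero (c : ℂ) : shiftedFactorial c 0 = 1 := by
  simp [shiftedFactorial]

theorem shiftedFactorial_natCast_succ (c : ℂ) (n : ℕ) :
    shiftedFactorial c (n + 1 : ℕ) = shiftedFactorial c n * (c + n) := by
  rw [shiftedFactorial_natCast, shiftedFactorial_natCast, Finset.prod_range_succ]

theorem shiftedFactorial_neg_natCast (c : ℂ) (n : ℕ) :
    shiftedFactorial c (-n) = ((-1) ^ n * shiftedFactorial (1 - c) n)⁻¹ := by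
  cases n with
  | zero => simp [shiftedFactorial_zero]
  | succ n =>
    rw [shiftedFactorial_natCast]
    change (∏ k ∈ Finset.range (n + 1), (c - (k + 1)))⁻¹ = _
    have e : (-1 : ℂ) ^ (n + 1) = ∏ _k ∈ Finset.range (n + 1), (-1) := by simp
    rw [e, ← Finset.prod_mul_distrib]
    congr 1
    refine Finset.prod_congr rfl fun k _ => ?_
    ring

theorem shiftedFactorial_natCast_eq_zero_iff (c : ℂ) (n : ℕ) :
    shiftedFactorial c n = 0 ↔ ∃ k < n, c = -(k : ℂ) := by
  simp [shiftedFactorial_natCast, Finset.prod_eq_zero_iff, add_eq_zero_iff_eq_neg]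

/-- Stated for `1/Γ`, the recurrence has no exceptional points, so poles need no separate treatment.
-/
theorem inv_Gamma_eq_shiftedFactorial_mul (c : ℂ) (n : ℕ) :
    (Gamma c)⁻¹ = shiftedFactorial c n * (Gamma (c + n))⁻¹ := by
  induction n with
  | zero => simp [shiftedFactorial_zero]
  | succ n ih =>
    rw [ih, one_div_Gamma_eq_self_mul_one_div_Gamma_add_one, shiftedFactorial_natCast_succ,
      Nat.cast_succ, add_assoc c, mul_assoc]

theorem inv_Gamma_sub_eq_shiftedFactorial_mul (b : ℂ) (n : ℕ) :
    (Gamma (b + 1 - n))⁻¹ = (-1) ^ n * shiftedFactorial (-b) n * (Gamma (b + 1))⁻¹ := by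
  induction n with
  | zero => simp [shiftedFactorial_zero]
  | succ n ih =>
    rw [one_div_Gamma_eq_self_mul_one_div_Gamma_add_one, shiftedFactorial_natCast_succ,
      show b + 1 - (n + 1 : ℕ) + 1 = b + 1 - n by push_cast; ring, ih]
    push_cast
    ring

theorem WellDefined.symm {m : ℕ} {a b : Fin m → ℂ}
    (h : WellDefined (fun j => -b j) (fun j => a j + 1)) :
    WellDefined (fun j => -a j) (fun j => b j + 1) := by
  refine ⟨fun j N hj => ?_, fun j N hj => ?_⟩
  · obtain ⟨i, M, hM, hi⟩ := h.2 j N (by linear_combination -hj)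
    exact ⟨i, M, hM, by linear_combination -hi⟩
  · obtain ⟨i, M, hM, hi⟩ := h.1 j N (by linear_combination -hj)
    exact ⟨i, M, hM, by linear_combination -hi⟩

/-- The signs from `(c)_{-n}` cancel because numerator and denominator both have `m` factors. -/
theorem term_neg_natCast {m : ℕ} (a b : Fin m → ℂ) (z : ℂ) (n : ℕ) :
    term (fun j => -b j) (fun j => a j + 1) z (-n) =
      term (fun j => -a j) (fun j => b j + 1) z⁻¹ n := by
  have h1 : ((-1 : ℂ) ^ n) ^ m ≠ 0 := pow_ne_zero _ (pow_ne_zero _ (by norm_num))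
  simp only [term, shiftedFactorial_neg_natCast, Finset.prod_inv_distrib,
    Finset.prod_mul_distrib, Finset.prod_const, Finset.card_univ, Fintype.card_fin, zpow_neg,
    inv_zpow]
  congr 1
  rw [inv_div_inv, mul_div_mul_left _ _ h1]
  congr 2 <;> ext j <;> congr 1 <;> ring

theorem C₀_mul_term_natCast {m : ℕ} {a b : Fin m → ℂ}
    (hwd : WellDefined (fun j => -b j) (fun j => a j + 1)) (z : ℂ) (n : ℕ) :
    C₀ a b * term (fun j => -b j) (fun j => a j + 1) z n = f a b n * ((-1) ^ m * z) ^ n := by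
  rw [f_eq_prod_factor, term, zpow_natCast]
  by_cases h : ∃ j, shiftedFactorial (a j + 1) n = 0
  · obtain ⟨j, hj⟩ := h
    obtain ⟨k, hk, hj'⟩ := (shiftedFactorial_natCast_eq_zero_iff _ _).1 hj
    obtain ⟨i, M, hM, hi⟩ := hwd.1 j k hj'
    -- The term is 0 by division by zero. By well-definedness the series has already terminated, so
    -- `(-b_i)_n = 0`, and `f(n)` vanishes too.
    rw [Finset.prod_eq_zero (f := fun j => shiftedFactorial (a j + 1) n) (Finset.mem_univ j) hj,
      Finset.prod_eq_zero (f := fun j => factor (a j) (b j) n) (Finset.mem_univ i)]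
    · simp
    · have h0 : shiftedFactorial (-b i) n = 0 :=
        (shiftedFactorial_natCast_eq_zero_iff _ _).2 ⟨M, by omega, hi⟩
      rw [factor, inv_Gamma_sub_eq_shiftedFactorial_mul, h0, mul_zero, zero_mul, mul_zero]
  · push Not at h
    have key : ∀ j, factor (a j) (b j) n = (Gamma (a j + 1) * Gamma (b j + 1))⁻¹ *
        ((-1) ^ n * (shiftedFactorial (-b j) n / shiftedFactorial (a j + 1) n)) := fun j => by
      have e1 := inv_Gamma_eq_shiftedFactorial_mul (a j + 1) n
      rw [factor, inv_Gamma_sub_eq_shiftedFactorial_mul, mul_inv, e1]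
      field_simp [h j]
    simp only [key, Finset.prod_mul_distrib, Finset.prod_const, Finset.card_univ,
      Fintype.card_fin, Finset.prod_div_distrib, Finset.prod_inv_distrib, C₀]
    have hsq : (((-1 : ℂ) ^ n) ^ m) * ((-1) ^ m) ^ n = 1 := by
      rw [← pow_mul, ← pow_mul, mul_comm m n, ← mul_pow]; norm_num
    rw [mul_pow]
    linear_combination (-((∏ x, Gamma (a x + 1)) * ∏ x, Gamma (b x + 1))⁻¹ *
      ((∏ j, shiftedFactorial (-b j) n) / ∏ j, shiftedFactorial (a j + 1) n) * z ^ n) * hsq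

theorem C₀_mul_term {m : ℕ} {a b : Fin m → ℂ}
    (hwd : WellDefined (fun j => -b j) (fun j => a j + 1)) (z : ℂ) (n : ℤ) :
    C₀ a b * term (fun j => -b j) (fun j => a j + 1) z n = f a b n * ((-1) ^ m * z) ^ n := by
  obtain ⟨n, rfl | rfl⟩ := n.eq_nat_or_neg
  · simpa using C₀_mul_term_natCast hwd z n
  · have hC : C₀ a b = C₀ b a := by simp only [C₀, mul_comm]
    rw [term_neg_natCast, hC, C₀_mul_term_natCast hwd.symm]
    push_cast
    rw [f_neg, zpow_neg, zpow_natCast, ← inv_pow, mul_inv, ← inv_pow, inv_neg, inv_one]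

/-- The quotient equals `Γ(a+1)/Γ(-b) · Γ(n-b)/Γ(n+a+1)`, with `1/Γ(-b)` read as 0 at poles. -/
theorem exists_norm_shiftedFactorial_div_le {a b : ℂ} (ha : ∀ N : ℕ, a + 1 ≠ -(N : ℂ)) :
    ∃ C : ℝ, 0 ≤ C ∧ ∀ᶠ n : ℕ in atTop,
      ‖shiftedFactorial (-b) n / shiftedFactorial (a + 1) n‖ ≤
        C * (n : ℝ) ^ (-(a + b + 1).re) := by
  obtain ⟨k, C, R₀, hk, hC, hR₀, h⟩ := exists_norm_Gamma_sub_div_Gamma_add_le a b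
  refine ⟨‖Gamma (a + 1) * (Gamma (-b))⁻¹‖ * C, by positivity, ?_⟩
  filter_upwards [tendsto_natCast_atTop_atTop.eventually (eventually_ge_atTop R₀)] with n hn
  have hn0 : (0 : ℝ) < n := by linarith
  obtain ⟨hpos, hle⟩ := h n (by simpa using hn)
  have hG1 : Gamma (n - b) ≠ 0 := Gamma_ne_zero_of_re_pos hpos
  have hG2 : Gamma (a + 1) ≠ 0 := Gamma_ne_zero ha
  have e1 := inv_Gamma_eq_shiftedFactorial_mul (-b) n
  have e2 := inv_Gamma_eq_shiftedFactorial_mul (a + 1) n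
  rw [neg_add_eq_sub] at e1
  have hne : shiftedFactorial (a + 1) n ≠ 0 := fun h0 => by
    rw [h0, zero_mul] at e2; exact inv_ne_zero hG2 e2
  have e : shiftedFactorial (-b) n / shiftedFactorial (a + 1) n =
      (Gamma (a + 1) * (Gamma (-b))⁻¹) * (Gamma (n - b) * (Gamma (n - b + (a + b + 1)))⁻¹) := by
    have e3 : (Gamma (n - b + (a + b + 1)))⁻¹ =
        (Gamma (a + 1))⁻¹ / shiftedFactorial (a + 1) n := by
      rw [e2, show (n : ℂ) - b + (a + b + 1) = a + 1 + n by ring]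
      field_simp
    rw [e1, e3]
    field_simp
  rw [e, norm_mul, mul_assoc]
  gcongr
  refine hle.trans (le_of_eq ?_)
  rw [norm_natCast, natCast_re, neg_add, Real.rpow_add hn0, Real.rpow_neg hn0.le (k : ℝ),
    Real.rpow_natCast]
  field_simp

/-- The decay of `f(n)` does not suffice, since `C₀` may be 0. Either some `b_i` is a natural number
and the series is finite, or well-definedness keeps every `a_j + 1` off the poles. -/
theorem summable_term_natCast {m : ℕ} {a b : Fin m → ℂ} (hab : 1 < ∑ j, (a j + b j + 1).re)
    (hwd : WellDefined (fun j => -b j) (fun j => a j + 1)) {z : ℂ} (hz : ‖z‖ = 1) :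
    Summable fun n : ℕ => term (fun j => -b j) (fun j => a j + 1) z n := by
  by_cases hb : ∃ (i : Fin m) (M : ℕ), -b i = -(M : ℂ)
  · obtain ⟨i, M, hi⟩ := hb
    refine summable_of_ne_finset_zero (s := Finset.range (M + 1)) fun n hn => ?_
    rw [term, Finset.prod_eq_zero (Finset.mem_univ i), zero_div, zero_mul]
    exact (shiftedFactorial_natCast_eq_zero_iff _ _).2 ⟨M, by simpa using hn, hi⟩
  · push Not at hb
    have ha : ∀ j, ∀ N : ℕ, a j + 1 ≠ -(N : ℂ) := fun j N h => by
      obtain ⟨i, M, -, hi⟩ := hwd.1 j N h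
      exact hb i M hi
    choose C hC h using fun j => exists_norm_shiftedFactorial_div_le (b := b j) (ha j)
    refine summable_of_isBigO_nat (Real.summable_nat_rpow.2 (neg_lt_neg hab)) ?_
    refine Asymptotics.IsBigO.of_bound (∏ j, C j) ?_
    filter_upwards [eventually_all.2 h, eventually_gt_atTop 0] with n h hn
    have hn0 : (0 : ℝ) < n := by exact_mod_cast hn
    rw [Real.norm_of_nonneg (by positivity), term, norm_mul, norm_zpow, hz, one_zpow, mul_one,
      ← Finset.prod_div_distrib, norm_prod]
    refine (Finset.prod_le_prod (fun j _ => norm_nonneg _) fun j _ => h j).trans (le_of_eq ?_)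
    rw [Finset.prod_mul_distrib, ← Real.rpow_sum_of_pos hn0, Finset.sum_neg_distrib]

theorem summable_term {m : ℕ} {a b : Fin m → ℂ} (hab : 1 < ∑ j, (a j + b j + 1).re)
    (hwd : WellDefined (fun j => -b j) (fun j => a j + 1)) {z : ℂ} (hz : ‖z‖ = 1) :
    Summable (term (fun j => -b j) (fun j => a j + 1) z) := by
  refine Summable.of_nat_of_neg (summable_term_natCast hab hwd hz) ?_
  simp only [term_neg_natCast]
  exact summable_term_natCast (by simpa only [add_comm (b _)] using hab) hwd.symm (by simp [hz])

/-! ### The kernel `g_m` as a cosine sum and as an exponential sum. -/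

theorem g_zero (x : ℝ) : g 0 x = 0 := by simp [g]

theorem g_one (x : ℝ) : g 1 x = 1 := by
  unfold g
  split_ifs with h
  · have : Real.cos (Real.pi * x) ≠ 0 := fun h' => by
      have := Real.sin_sq_add_cos_sq (Real.pi * x)
      rw [h, h'] at this
      norm_num at this
    simp [this]
  · simp [h]

theorem g_add_two (m : ℕ) (x : ℝ) :
    g (m + 2) x = g m x + 2 * Real.cos ((m + 1) * Real.pi * x) := by
  have e1 : ((m + 2 : ℕ) : ℝ) * Real.pi * x = (m + 1) * Real.pi * x + Real.pi * x := by
    push_cast; ring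
  have e2 : (m : ℝ) * Real.pi * x = (m + 1) * Real.pi * x - Real.pi * x := by ring
  unfold g
  rw [e1, e2]
  generalize (m + 1) * Real.pi * x = y
  generalize Real.pi * x = u
  have hsq := Real.sin_sq_add_cos_sq u
  split_ifs with h
  · have hc : Real.cos u ≠ 0 := fun h' => by
      rw [h, h'] at hsq; norm_num at hsq
    rw [Real.cos_add, Real.cos_sub, h]
    field_simp
    push_cast
    ring
  · rw [Real.sin_add, Real.sin_sub]
    field_simp
    ring

theorem g_eq_sum_cos (m : ℕ) (x : ℝ) :
    g m x = if Odd m then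
        1 + 2 * ∑ n ∈ Finset.Icc 1 ((m - 1) / 2), Real.cos (2 * n * Real.pi * x)
      else 2 * ∑ n ∈ Finset.Icc 1 (m / 2), Real.cos ((2 * n - 1) * Real.pi * x) := by
  split_ifs with h
  · obtain ⟨k, rfl⟩ := h
    rw [show (2 * k + 1 - 1) / 2 = k by omega]
    induction k with
    | zero => simp [g_one]
    | succ k ih =>
      rw [show 2 * (k + 1) + 1 = 2 * k + 1 + 2 by ring, g_add_two, ih,
        Finset.sum_Icc_succ_top (by omega)]
      rw [show ((2 * k + 1 : ℕ) : ℝ) + 1 = 2 * (k + 1 : ℕ) by push_cast; ring]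
      ring
  · obtain ⟨k, rfl⟩ := Nat.not_odd_iff_even.1 h
    rw [show (k + k) / 2 = k by omega]
    clear h
    induction k with
    | zero => simp [g_zero]
    | succ k ih =>
      rw [show (k + 1) + (k + 1) = k + k + 2 by ring, g_add_two, ih,
        Finset.sum_Icc_succ_top (by omega)]
      rw [show ((k + k : ℕ) : ℝ) + 1 = 2 * (k + 1 : ℕ) - 1 by push_cast; ring]
      ring

theorem g_eq_sum_exp (m : ℕ) (x : ℝ) :
    (g m x : ℂ) = ∑ k ∈ Finset.range m,
      cexp (-(I * x * ((Real.pi * (2 * k - (m - 1)) : ℝ) : ℂ))) := by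
  induction m using Nat.twoStepInduction with
  | zero => simp [g_zero]
  | one => simp [g_one]
  | more m ih _ =>
    -- Peeling off both ends leaves the sum for `m`; the two outer exponentials form the new cosine.
    rw [g_add_two, Finset.sum_range_succ', Finset.sum_range_succ, ofReal_add, ih, add_assoc]
    congr 1
    · refine Finset.sum_congr rfl fun k _ => ?_
      congr 3
      push_cast
      ring
    · rw [ofReal_mul, ofReal_cos, Complex.cos]
      push_cast
      rw [show ∀ p q : ℂ, 2 * ((p + q) / 2) = q + p by intros; ring]
      congr 2 <;> ring

/-! ### Poisson summation. -/

theorem fourier_mul_exp (F : ℝ → ℂ) (s ξ : ℝ) :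
    𝓕 (fun x : ℝ => F x * cexp (-(I * x * s))) ξ =
      ∫ x : ℝ, F x * cexp (-(I * x * (s + 2 * Real.pi * ξ : ℝ))) := by
  rw [Real.fourier_real_eq_integral_exp_smul]
  congr 1
  ext x
  rw [smul_eq_mul, mul_left_comm, ← Complex.exp_add]
  congr 2
  push_cast
  ring

theorem tsum_f_mul_exp {m : ℕ} {a b : Fin m → ℂ} (hab : 1 < ∑ j, (a j + b j + 1).re) (s : ℝ) :
    ∑' n : ℤ, f a b n * cexp (-(I * n * s)) =
      ∑' n : ℤ, ∫ x : ℝ, f a b x * cexp (-(I * x * (s + 2 * Real.pi * n : ℝ))) := by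
  have hc : Continuous fun x : ℝ => f a b x * cexp (-(I * x * s)) :=
    ((differentiable_f a b).continuous.comp continuous_ofReal).mul (by fun_prop)
  have ht : Tendsto (fun x : ℝ => |x|) (cocompact ℝ) atTop := tendsto_norm_cocompact_atTop
  have h := Real.tsum_eq_tsum_fourier_of_rpow_decay hc hab ?_ ?_ 0
  · simpa [fourier_mul_exp] using h
  · refine Asymptotics.IsBigO.trans (.of_bound 1 (.of_forall fun x => ?_))
      (f_isBigO_cocompact a b)
    rw [norm_mul, norm_exp_neg_I_mul_mul, mul_one, one_mul]
  · refine Asymptotics.IsBigO.of_bound 1 ?_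
    -- Beyond this threshold `|s + 2πξ| ≥ mπ`, so the transform is exactly 0 and its decay is
    -- trivial.
    filter_upwards [ht.eventually (eventually_ge_atTop (m * Real.pi + |s|))] with ξ hξ
    rw [fourier_mul_exp, integral_f_mul_exp_eq_zero hab]
    · simp only [norm_zero]; positivity
    · have h1 := abs_sub_abs_le_abs_sub (2 * Real.pi * ξ) (-s)
      rw [abs_neg, sub_neg_eq_add, add_comm, abs_mul, abs_mul, abs_of_pos Real.pi_pos,
        abs_two] at h1
      nlinarith [Real.pi_gt_three, abs_nonneg ξ]

/-- For `n ≤ -1` the frequency is at most `t - π(m+1) ≤ -mπ`, and for `n ≥ m` at least `t + π(m+1) ≥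
mπ`. -/
theorem tsum_integral_eq_sum_range {m : ℕ} {a b : Fin m → ℂ}
    (hab : 1 < ∑ j, (a j + b j + 1).re) {t : ℝ} (ht : t ∈ Set.Icc (-Real.pi) Real.pi) :
    ∑' n : ℤ, ∫ x : ℝ, f a b x *
        cexp (-(I * x * (t - Real.pi * (m - 1) + 2 * Real.pi * n : ℝ))) =
      ∑ k ∈ Finset.range m, ∫ x : ℝ, f a b x *
        cexp (-(I * x * (t - Real.pi * (m - 1) + 2 * Real.pi * k : ℝ))) := by
  rw [tsum_eq_sum (s := (Finset.range m).map Nat.castEmbedding)]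
  · simp
  · intro n hn
    refine integral_f_mul_exp_eq_zero hab ?_
    have hpi := Real.pi_pos
    rcases lt_or_ge n 0 with h | h
    · have h' : (n : ℝ) ≤ -1 := by exact_mod_cast Int.le_sub_one_of_lt h
      rw [le_abs]
      right
      nlinarith [ht.2]
    · lift n to ℕ using h
      have h' : (m : ℝ) ≤ n := by
        by_contra hlt
        exact hn (by simpa using hlt)
      rw [le_abs]
      left
      push_cast
      nlinarith [ht.1]

end BilateralHyp

theorem theorem4p3 (m : ℕ) (a b : Fin m → ℂ)
    (hab : 1 < ∑ j, (a j + b j + 1).re)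
    (hwd : BilateralHyp.WellDefined (fun j => -b j) (fun j => a j + 1))
    (t : ℝ) (ht : t ∈ Set.Icc (-Real.pi) Real.pi) :
    -- the two expressions for `g_m`
    (∀ x : ℝ, BilateralHyp.g m x =
      if Odd m then 1 + 2 * ∑ n ∈ Finset.Icc 1 ((m - 1) / 2), Real.cos (2 * n * Real.pi * x)
      else 2 * ∑ n ∈ Finset.Icc 1 (m / 2), Real.cos ((2 * n - 1) * Real.pi * x)) ∧
    -- the bilateral series converges absolutely
    Summable (BilateralHyp.term (fun j => -b j) (fun j => a j + 1)
      (-Complex.exp (-(Complex.I * t)))) ∧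
    -- the integral converges absolutely
    MeasureTheory.Integrable (fun x : ℝ =>
      BilateralHyp.f a b x * Complex.exp (-(Complex.I * x * t)) * (BilateralHyp.g m x : ℂ)) ∧
    -- the integral representation
    BilateralHyp.C₀ a b * BilateralHyp.pHq (fun j => -b j) (fun j => a j + 1)
        (-Complex.exp (-(Complex.I * t))) =
      ∫ x : ℝ,
        BilateralHyp.f a b x * Complex.exp (-(Complex.I * x * t)) * (BilateralHyp.g m x : ℂ) := by
  set z : ℂ := -Complex.exp (-(Complex.I * t)) with hzdef
  have hz : ‖z‖ = 1 := by
    rw [hzdef, norm_neg, Complex.norm_exp]; simp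
  have hexp : ∀ x : ℝ, BilateralHyp.f a b x * Complex.exp (-(Complex.I * x * t)) *
      (BilateralHyp.g m x : ℂ) = ∑ k ∈ Finset.range m, BilateralHyp.f a b x * Complex.exp
        (-(Complex.I * x * (t - Real.pi * (m - 1) + 2 * Real.pi * k : ℝ))) := fun x => by
    rw [BilateralHyp.g_eq_sum_exp, Finset.mul_sum]
    refine Finset.sum_congr rfl fun k _ => ?_
    rw [mul_assoc, ← Complex.exp_add]
    congr 2
    push_cast
    ring
  have hint : ∀ k ∈ Finset.range m, MeasureTheory.Integrable fun x : ℝ =>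
      BilateralHyp.f a b x * Complex.exp
        (-(Complex.I * x * (t - Real.pi * (m - 1) + 2 * Real.pi * k : ℝ))) := fun k _ =>
    BilateralHyp.integrable_mul_exp (BilateralHyp.integrable_f hab) _
  refine ⟨BilateralHyp.g_eq_sum_cos m, BilateralHyp.summable_term hab hwd hz, ?_, ?_⟩
  · simp only [hexp]
    exact MeasureTheory.integrable_finsetSum _ hint
  · simp only [hexp]
    rw [MeasureTheory.integral_finsetSum _ hint,
      ← BilateralHyp.tsum_integral_eq_sum_range hab ht, ← BilateralHyp.tsum_f_mul_exp hab,
      BilateralHyp.pHq, ← tsum_mul_left]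
    congr 1
    ext n
    rw [BilateralHyp.C₀_mul_term hwd]
    congr 1
    -- The sign in `z = -e^{-it}` turns `(-1)^m` into `(-1)^(m-1) = e^{iπ(m-1)}`, which centres the
    -- `m` surviving frequencies at `t`.
    have e : (-1) ^ m * z = Complex.exp (-(Complex.I * (t - Real.pi * (m - 1) : ℝ))) := by
      have e1 : Complex.exp (-(Complex.I * (t - Real.pi * (m - 1) : ℝ))) =
          Complex.exp (-(Complex.I * t)) * Complex.exp (m * (Real.pi * Complex.I)) *
            Complex.exp (-(Real.pi * Complex.I)) := by
        rw [← Complex.exp_add, ← Complex.exp_add]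
        congr 1
        push_cast
        ring
      rw [e1, Complex.exp_nat_mul, Complex.exp_neg (Real.pi * Complex.I), Complex.exp_pi_mul_I,
        hzdef]
      ring
    rw [e, ← Complex.exp_int_mul]
    congr 1
    ring
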